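/- All graphs are finite and simple. A separation of a graph $G$ is a pair $(A,B)$ of edge-disjoint subgraphs of $G$ with $A\cup B=G$; its order is $|V(A)\cap V(B)|$, and it is balanced if $|V(A)\setminus V(B)|\le\frac23|V(G)|$ and $|V(B)\setminus V(A)|\le\frac23|V(G)|$. A graph class $\mathcal{G}$ has strongly sublinear separators if there exist $c>0$ and $\beta\in[0,1)$ such that for every $G\in\mathcal{G}$, every subgraph $H$ of $G$ has a balanced separation of order at most $c|V(H)|^\beta$. Graph classes $\mathcal{G}_1,\mathcal{G}_2$ have joint polynomial growth if there is a polynomial $p$ such that for every $r\in\mathbb{N}$ there is $i\in\{1,2\}$ such that for every $G\in\mathcal{G}_i$ and every vertex $v$ of $G$, at most $p(r)$ vertices of $G$ are at distance at most $r$ from $v$. The strong product $G_1\boxtimes G_2$ has vertex set $V(G_1)\times V(G_2)$, where distinct vertices $(v,x),(w,y)$ are adjacent if $v=w$ and $xy\in E(G_2)$, or $x=y$ and $vw\in E(G_1)$, or $vw\in E(G_1)$ and $xy\in E(G_2)$. Let $\mathcal{G}_1\boxtimes\mathcal{G}_2$ be the class of all graphs isomorphic to a subgraph of $G_1\boxtimes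 G_2$ for some $G_1\in\mathcal{G}_1$ and $G_2\in\mathcal{G}_2$. **Lemma.** If $\mathcal{G}_1$ and $\mathcal{G}_2$ are graph classes with strongly sublinear separators and with joint polynomial growth, then $\mathcal{G}_1\boxtimes\mathcal{G}_2$ has strongly sublinear separators. -/

import Mathlib

universe u

/-- A finite simple graph, bundled with its vertex type. -/
structure FinGraph : Type (u + 1) where
  /-- The vertex type. -/
  V : Type u
  /-- There are finitely many vertices. -/
  finite : Finite V
  /-- The graph on these vertices. -/
  graph : SimpleGraph V

/-- A class of finite graphs. Closure under isomorphism or under subgraphs is not required. -/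
abbrev GraphClass : Type (u + 1) := Set FinGraph.{u}

namespace GraphProduct

section Graphs

variable {V W : Type u}

/-- The strong product of two graphs. -/
def strongProd (G : SimpleGraph V) (H : SimpleGraph W) : SimpleGraph (V × W) where
  Adj p q :=
    (p.1 = q.1 ∧ H.Adj p.2 q.2) ∨ (p.2 = q.2 ∧ G.Adj p.1 q.1) ∨ (G.Adj p.1 q.1 ∧ H.Adj p.2 q.2)
  symm := ⟨fun _ _ h => by
    rcases h with ⟨h₁, h₂⟩ | ⟨h₁, h₂⟩ | ⟨h₁, h₂⟩
    · exact Or.inl ⟨h₁.symm, h₂.symm⟩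
    · exact Or.inr (Or.inl ⟨h₁.symm, h₂.symm⟩)
    · exact Or.inr (Or.inr ⟨h₁.symm, h₂.symm⟩)⟩
  loopless := ⟨fun _ h => by
    rcases h with ⟨-, h⟩ | ⟨-, h⟩ | ⟨h, -⟩
    · exact H.irrefl h
    · exact G.irrefl h
    · exact G.irrefl h⟩

/-- The `r`-ball around `v`: all vertices at distance at most `r` from `v`, where vertices in
different components are at infinite distance. -/
def closedBall (G : SimpleGraph V) (v : V) (r : ℕ) : Set V :=
  {u | G.edist v u ≤ (r : ℕ∞)}

/-- `(A, B)` is a separation of `G`: two edge-disjoint subgraphs whose union is `G`. -/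
def IsSeparation {G : SimpleGraph V} (A B : G.Subgraph) : Prop :=
  A ⊔ B = ⊤ ∧ Disjoint A.edgeSet B.edgeSet

/-- The order of the pair `(A, B)`: the number of common vertices. -/
noncomputable def sepOrder {G : SimpleGraph V} (A B : G.Subgraph) : ℕ :=
  (A.verts ∩ B.verts).ncard

/-- `(A, B)` is a balanced separation of `G`. -/
def IsBalancedSeparation {G : SimpleGraph V} (A B : G.Subgraph) : Prop :=
  IsSeparation A B ∧
    ((A.verts \ B.verts).ncard : ℝ) ≤ 2 / 3 * (Nat.card V : ℝ) ∧
    ((B.verts \ A.verts).ncard : ℝ) ≤ 2 / 3 * (Nat.card V : ℝ)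

end Graphs

/-- The class `𝒢` admits strongly sublinear separators. -/
def HasStronglySublinearSeparators (𝒢 : GraphClass.{u}) : Prop :=
  ∃ c β : ℝ, 0 < c ∧ 0 ≤ β ∧ β < 1 ∧
    ∀ G ∈ 𝒢, ∀ H : G.graph.Subgraph, ∃ A B : H.coe.Subgraph,
      IsBalancedSeparation A B ∧ (sepOrder A B : ℝ) ≤ c * (Nat.card H.verts : ℝ) ^ β

/-- For every `G` in the class `𝒢`, every `r`-ball in `G` has at most `b` vertices. -/
def BallsBoundedBy (𝒢 : GraphClass.{u}) (r : ℕ) (b : ℝ) : Prop :=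
  ∀ G ∈ 𝒢, ∀ v : G.V, ((closedBall G.graph v r).ncard : ℝ) ≤ b

/-- The classes `𝒢₁` and `𝒢₂` have joint polynomial growth. Which of the two classes has small
`r`-balls may depend on `r`. -/
def JointPolynomialGrowth (𝒢₁ 𝒢₂ : GraphClass.{u}) : Prop :=
  ∃ p : Polynomial ℝ, ∀ r : ℕ,
    BallsBoundedBy 𝒢₁ r (p.eval (r : ℝ)) ∨ BallsBoundedBy 𝒢₂ r (p.eval (r : ℝ))

/-- The class `𝒢₁ ⊠ 𝒢₂` of all graphs that are (up to isomorphism) subgraphs of the strong product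
of a graph of `𝒢₁` and a graph of `𝒢₂`. -/
def strongProdClass (𝒢₁ 𝒢₂ : GraphClass.{u}) : GraphClass.{u} :=
  {G | ∃ G₁ ∈ 𝒢₁, ∃ G₂ ∈ 𝒢₂, G.graph.IsContained (strongProd G₁.graph G₂.graph)}

end GraphProduct

/-! Let `H` be a subgraph of the product with `n` vertices, and fix a scale `k` close to a small
power of `n`. Joint growth at radius `k ^ 2` gives a factor, say `G₂`, whose balls have at most `M`
vertices, with `M` polynomial in `k`. Weight each vertex of `G₂` by the size of its fibre in `H`. A
ball grown around a heaviest vertex cannot gain a factor `1 + 1/k` in weight at every one of `k ^ 2`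
steps, since `(1 + 1/k) ^ (k ^ 2) ≥ 2 ^ k > M`. Hence some ball has a boundary weighing at most
`1/k` of the ball (`exists_isSplit_light_boundary`). Carving off such balls (`exists_carving`) costs
at most `n / k` in total and leaves parts that can be grouped in a balanced way, unless a single
ball `C` carries over two thirds of the weight. In that case the fibre over `C` embeds in `G₁ ⊠ C`,
and a weighted separator of `G₁` (`HasBalancedSplits.weighted`) times `C` splits it at cost `O(M * n
^ β)`. `exists_isSplit_of_maps` combines these cases, and `exists_sublinear_bound` chooses `k` so
that `n / k + O(M * n ^ β)` is strongly sublinear. -/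

namespace GraphProduct

open Finset Classical

/-! ### Vertex partitions in place of separations, and weighted separators. -/

section Splits

variable {V W : Type u}

/-- `A`, `B` and `S` partition `U`, and `G` has no edge between `A` and `B`. -/
structure IsSplit (G : SimpleGraph V) (U A B S : Finset V) : Prop where
  union : A ∪ B ∪ S = U
  disjoint_left_right : Disjoint A B
  disjoint_left_sep : Disjoint A S
  disjoint_right_sep : Disjoint B S
  not_adj : ∀ a ∈ A, ∀ b ∈ B, ¬ G.Adj a b

namespace IsSplit

variable {G : SimpleGraph V} {U A B S A' B' S' : Finset V}

lemma symm (h : IsSplit G U A B S) : IsSplit G U B A S where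
  union := by rw [union_comm B A, h.union]
  disjoint_left_right := h.disjoint_left_right.symm
  disjoint_left_sep := h.disjoint_right_sep
  disjoint_right_sep := h.disjoint_left_sep
  not_adj a ha b hb hab := h.not_adj b hb a ha hab.symm

lemma left_subset (h : IsSplit G U A B S) : A ⊆ U := by
  rw [← h.union, union_assoc]; exact subset_union_left

lemma right_subset (h : IsSplit G U A B S) : B ⊆ U := h.symm.left_subset

lemma sep_subset (h : IsSplit G U A B S) : S ⊆ U := by
  rw [← h.union]; exact subset_union_right

lemma empty_left (G : SimpleGraph V) (U : Finset V) : IsSplit G U ∅ U ∅ := by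
  constructor <;> simp

lemma sum (h : IsSplit G U A B S) (w : V → ℕ) :
    ∑ x ∈ A, w x + ∑ x ∈ B, w x + ∑ x ∈ S, w x = ∑ x ∈ U, w x := by
  rw [← h.union, sum_union, sum_union h.disjoint_left_right]
  rw [disjoint_union_left]
  exact ⟨h.disjoint_left_sep, h.disjoint_right_sep⟩

lemma card (h : IsSplit G U A B S) : #A + #B + #S = #U := by
  simpa using h.sum (fun _ => 1)

/-- Splitting the left part of a split further. -/
lemma refine (h : IsSplit G U A B S) (h' : IsSplit G A A' B' S') :
    IsSplit G U A' (B' ∪ B) (S' ∪ S) where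
  union := by
    rw [← h.union, ← h'.union]; ext x; simp only [mem_union]; tauto
  disjoint_left_right := disjoint_union_right.2
    ⟨h'.disjoint_left_right, disjoint_of_subset_left h'.left_subset h.disjoint_left_right⟩
  disjoint_left_sep := disjoint_union_right.2
    ⟨h'.disjoint_left_sep, disjoint_of_subset_left h'.left_subset h.disjoint_left_sep⟩
  disjoint_right_sep := by
    rw [disjoint_union_left, disjoint_union_right, disjoint_union_right]
    exact ⟨⟨h'.disjoint_right_sep, disjoint_of_subset_left h'.right_subset h.disjoint_left_sep⟩,
      disjoint_of_subset_right h'.sep_subset h.disjoint_left_right.symm, h.disjoint_right_sep⟩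
  not_adj a ha b hb := by
    rcases mem_union.1 hb with hb | hb
    · exact h'.not_adj a ha b hb
    · exact h.not_adj a (h'.left_subset ha) b hb

lemma disjoint_right_of_left (h : IsSplit G U A B S) (h' : IsSplit G A A' B' S') :
    Disjoint B' B := disjoint_of_subset_left h'.right_subset h.disjoint_left_right

/-- Refining a split whose left part is too heavy by a split of the left part keeps balance. -/
lemma exists_refine_balanced (h : IsSplit G U A B S) (h' : IsSplit G A A' B' S') (w : V → ℕ)
    {N : ℕ} (hU : ∑ x ∈ U, w x ≤ N) (hA : 2 * N < 3 * ∑ x ∈ A, w x)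
    (hA' : 3 * ∑ x ∈ A', w x ≤ 2 * N) (hB' : 3 * ∑ x ∈ B', w x ≤ 2 * N) :
    ∃ A₁ B₁, IsSplit G U A₁ B₁ (S' ∪ S) ∧
      3 * ∑ x ∈ A₁, w x ≤ 2 * N ∧ 3 * ∑ x ∈ B₁, w x ≤ 2 * N := by
  have e := h.sum w
  have e' := h'.sum w
  -- The lighter piece of `A` joins `B`: the union weighs at most `w(A)/2 + w(B) ≤ N - w(A)/2 <
  -- 2N/3`.
  rcases le_total (∑ x ∈ B', w x) (∑ x ∈ A', w x) with hle | hle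
  · refine ⟨_, _, h.refine h', hA', ?_⟩
    rw [sum_union (h.disjoint_right_of_left h')]
    omega
  · refine ⟨_, _, h.refine h'.symm, hB', ?_⟩
    rw [sum_union (h.disjoint_right_of_left h'.symm)]
    omega

/-- Splits pull back along maps that contract or preserve each edge. -/
lemma preimage {H : SimpleGraph W} (h : IsSplit G U A B S) (f : W → V)
    (hf : ∀ x y, H.Adj x y → f x = f y ∨ G.Adj (f x) (f y)) (T : Finset W) :
    IsSplit H {x ∈ T | f x ∈ U} {x ∈ T | f x ∈ A} {x ∈ T | f x ∈ B} {x ∈ T | f x ∈ S} where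
  union := by
    ext x; simp only [mem_union, mem_filter, ← h.union]; tauto
  disjoint_left_right := disjoint_left.2 fun x hx hx' =>
    disjoint_left.1 h.disjoint_left_right (mem_filter.1 hx).2 (mem_filter.1 hx').2
  disjoint_left_sep := disjoint_left.2 fun x hx hx' =>
    disjoint_left.1 h.disjoint_left_sep (mem_filter.1 hx).2 (mem_filter.1 hx').2
  disjoint_right_sep := disjoint_left.2 fun x hx hx' =>
    disjoint_left.1 h.disjoint_right_sep (mem_filter.1 hx).2 (mem_filter.1 hx').2
  not_adj a ha b hb hab := by
    rw [mem_filter] at ha hb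
    rcases hf a b hab with e | e
    · exact disjoint_left.1 h.disjoint_left_right ha.2 (e ▸ hb.2)
    · exact h.not_adj _ ha.2 _ hb.2 e

end IsSplit

/-- A balanced separation from a balanced split of the whole vertex set. -/
lemma IsSplit.exists_isBalancedSeparation [Fintype V] {G : SimpleGraph V} {A B S : Finset V}
    (h : IsSplit G univ A B S) (hA : 3 * #A ≤ 2 * Fintype.card V)
    (hB : 3 * #B ≤ 2 * Fintype.card V) :
    ∃ A' B' : G.Subgraph, IsBalancedSeparation A' B' ∧ sepOrder A' B' = #S := by
  have hm : ∀ x, x ∈ A ∨ x ∈ B ∨ x ∈ S := fun x => by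
    have := mem_univ x
    rw [← h.union] at this
    simpa [or_assoc] using this
  have d₁ : ∀ x ∈ A, x ∉ B := fun x hx hx' => disjoint_left.1 h.disjoint_left_right hx hx'
  have d₂ : ∀ x ∈ A, x ∉ S := fun x hx hx' => disjoint_left.1 h.disjoint_left_sep hx hx'
  have d₃ : ∀ x ∈ B, x ∉ S := fun x hx hx' => disjoint_left.1 h.disjoint_right_sep hx hx'
  -- Edges touching `B` go to `B'` and all others, including those inside `S`, to `A'`; this makes
  -- the two edge-disjoint.
  let A' : G.Subgraph :=
    { verts := {x | x ∉ B}
      Adj := fun x y => G.Adj x y ∧ x ∉ B ∧ y ∉ B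
      adj_sub := fun h => h.1
      edge_vert := fun h => h.2.1
      symm := ⟨fun _ _ h => ⟨h.1.symm, h.2.2, h.2.1⟩⟩ }
  let B' : G.Subgraph :=
    { verts := {x | x ∉ A}
      Adj := fun x y => G.Adj x y ∧ (x ∈ B ∨ y ∈ B)
      adj_sub := fun h => h.1
      edge_vert := by
        rintro x y ⟨hxy, hx | hy⟩
        · exact fun hA => d₁ x hA hx
        · exact fun hA => h.not_adj x hA y hy hxy
      symm := ⟨fun _ _ h => ⟨h.1.symm, h.2.symm⟩⟩ }
  have e₁ : A'.verts \ B'.verts = (A : Set V) := by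
    ext x
    have := d₁ x
    simp only [A', B', Set.mem_sdiff, Set.mem_ofPred_eq, mem_coe]; tauto
  have e₂ : B'.verts \ A'.verts = (B : Set V) := by
    ext x
    have := d₁ x
    simp only [A', B', Set.mem_sdiff, Set.mem_ofPred_eq, mem_coe]; tauto
  have e₃ : A'.verts ∩ B'.verts = (S : Set V) := by
    ext x
    have := hm x
    have := d₂ x
    have := d₃ x
    simp only [A', B', Set.mem_inter_iff, Set.mem_ofPred_eq, mem_coe]; tauto
  refine ⟨A', B', ⟨⟨?_, ?_⟩, ?_, ?_⟩, ?_⟩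
  · ext x y
    · have := d₁ x
      simp only [A', B', SimpleGraph.Subgraph.verts_sup, SimpleGraph.Subgraph.verts_top,
        Set.mem_union, Set.mem_ofPred_eq, Set.mem_univ, iff_true]
      tauto
    · simp only [A', B', SimpleGraph.Subgraph.sup_adj, SimpleGraph.Subgraph.top_adj]
      tauto
  · rw [Set.disjoint_left]
    intro e
    induction e with
    | _ x y =>
      simp only [A', B', SimpleGraph.Subgraph.mem_edgeSet]
      tauto
  · rw [e₁, Set.ncard_coe_finset, Nat.card_eq_fintype_card]
    have : (3 * #A : ℝ) ≤ 2 * Fintype.card V := by exact_mod_cast hA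
    linarith
  · rw [e₂, Set.ncard_coe_finset, Nat.card_eq_fintype_card]
    have : (3 * #B : ℝ) ≤ 2 * Fintype.card V := by exact_mod_cast hB
    linarith
  · rw [sepOrder, e₃, Set.ncard_coe_finset]

/-- Every finite vertex set `U` of `G` has a balanced split of order at most `c * #U ^ β`. -/
def HasBalancedSplits (G : SimpleGraph V) (c β : ℝ) : Prop :=
  ∀ U : Finset V, ∃ A B S, IsSplit G U A B S ∧ 3 * #A ≤ 2 * #U ∧ 3 * #B ≤ 2 * #U ∧
    (#S : ℝ) ≤ c * (#U : ℝ) ^ β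

lemma IsSeparation.not_adj {G : SimpleGraph V} {A B : G.Subgraph} (h : IsSeparation A B) {x y : V}
    (hx : x ∉ B.verts) (hy : y ∉ A.verts) : ¬ G.Adj x y := by
  intro hxy
  have : (A ⊔ B).Adj x y := by rw [h.1]; exact hxy
  rcases SimpleGraph.Subgraph.sup_adj.1 this with h | h
  · exact hy h.snd_mem
  · exact hx h.fst_mem

lemma HasBalancedSplits.of_subgraph_separations {G : SimpleGraph V} {c β : ℝ}
    (h : ∀ H : G.Subgraph, ∃ A B : H.coe.Subgraph,
      IsBalancedSeparation A B ∧ (sepOrder A B : ℝ) ≤ c * (Nat.card H.verts : ℝ) ^ β) :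
    HasBalancedSplits G c β := by
  intro U
  let H : G.Subgraph := (⊤ : G.Subgraph).induce (U : Set V)
  obtain ⟨A, B, ⟨hs, hA, hB⟩, hS⟩ := h H
  have hcard : Nat.card H.verts = #U := by
    change Nat.card (U : Set V) = _
    simp
  have : Finite H.verts := by change Finite (U : Set V); infer_instance
  have key : ∀ T : Set H.verts, ∃ T' : Finset V, #T' = T.ncard ∧
      ∀ x, x ∈ T' ↔ ∃ hx : x ∈ U, (⟨x, hx⟩ : H.verts) ∈ T := by
    intro T
    have hfin : (Subtype.val '' T).Finite := T.toFinite.image _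
    refine ⟨hfin.toFinset, ?_, fun x => ?_⟩
    · rw [← Set.ncard_eq_toFinset_card _ hfin, Set.ncard_image_of_injective _ Subtype.val_injective]
    · simp only [Set.Finite.mem_toFinset, Set.mem_image, Subtype.exists, exists_and_right,
        exists_eq_right]
      rfl
  obtain ⟨A', hA'c, hA'⟩ := key (A.verts \ B.verts)
  obtain ⟨B', hB'c, hB'⟩ := key (B.verts \ A.verts)
  obtain ⟨S', hS'c, hS'⟩ := key (A.verts ∩ B.verts)
  have hcov : ∀ x : H.verts, x ∈ A.verts ∨ x ∈ B.verts := fun x => by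
    have : x ∈ (A ⊔ B).verts := by rw [hs.1]; trivial
    exact this
  rw [hcard] at hA hB hS
  refine ⟨A', B', S', ⟨?_, ?_, ?_, ?_, ?_⟩, ?_, ?_, ?_⟩
  · ext x
    simp only [mem_union, hA', hB', hS']
    constructor
    · rintro ((⟨hx, -⟩ | ⟨hx, -⟩) | ⟨hx, -⟩) <;> exact hx
    · intro hx
      have := hcov ⟨x, hx⟩
      by_cases ha : (⟨x, hx⟩ : H.verts) ∈ A.verts <;>
      by_cases hb : (⟨x, hx⟩ : H.verts) ∈ B.verts
      · exact Or.inr ⟨hx, ha, hb⟩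
      · exact Or.inl (Or.inl ⟨hx, ha, hb⟩)
      · exact Or.inl (Or.inr ⟨hx, hb, ha⟩)
      · tauto
  · refine disjoint_left.2 fun x hx hx' => ?_
    obtain ⟨_, h₁⟩ := (hA' x).1 hx
    obtain ⟨_, h₂⟩ := (hB' x).1 hx'
    exact h₁.2 h₂.1
  · refine disjoint_left.2 fun x hx hx' => ?_
    obtain ⟨_, h₁⟩ := (hA' x).1 hx
    obtain ⟨_, h₂⟩ := (hS' x).1 hx'
    exact h₁.2 h₂.2
  · refine disjoint_left.2 fun x hx hx' => ?_
    obtain ⟨_, h₁⟩ := (hB' x).1 hx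
    obtain ⟨_, h₂⟩ := (hS' x).1 hx'
    exact h₁.2 h₂.1
  · intro a ha b hb hab
    obtain ⟨ha', h₁⟩ := (hA' a).1 ha
    obtain ⟨hb', h₂⟩ := (hB' b).1 hb
    exact hs.not_adj h₁.2 h₂.2 ⟨ha', hb', hab⟩
  · rw [← hA'c] at hA
    have : (3 * #A' : ℝ) ≤ 2 * #U := by linarith
    exact_mod_cast this
  · rw [← hB'c] at hB
    have : (3 * #B' : ℝ) ≤ 2 * #U := by linarith
    exact_mod_cast this
  · rw [hS'c]; exact hS

/-- Balanced splits with respect to cardinality yield balanced splits with respect to any weight. -/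
lemma HasBalancedSplits.weighted {G : SimpleGraph V} {c β : ℝ} (h : HasBalancedSplits G c β)
    (hc : 0 < c) (hβ : 0 < β) (w : V → ℕ) (N : ℕ) (U : Finset V) (hU : ∑ x ∈ U, w x ≤ N) :
    ∃ A B S, IsSplit G U A B S ∧ 3 * ∑ x ∈ A, w x ≤ 2 * N ∧ 3 * ∑ x ∈ B, w x ≤ 2 * N ∧
      (#S : ℝ) ≤ c / (1 - (2 / 3) ^ β) * (#U : ℝ) ^ β := by
  have hq : (2 / 3 : ℝ) ^ β < 1 := Real.rpow_lt_one (by norm_num) (by norm_num) hβ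
  have hq0 : (0 : ℝ) ≤ (2 / 3 : ℝ) ^ β := by positivity
  set q : ℝ := (2 / 3 : ℝ) ^ β with hqdef
  have hle : c ≤ c / (1 - q) := by
    rw [le_div_iff₀ (by linarith)]; nlinarith
  have heavy : ∀ A B S, IsSplit G U A B S → 3 * #A ≤ 2 * #U →
      (#S : ℝ) ≤ c * (#U : ℝ) ^ β → 2 * N < 3 * ∑ x ∈ A, w x →
      ∃ A B S, IsSplit G U A B S ∧ 3 * ∑ x ∈ A, w x ≤ 2 * N ∧ 3 * ∑ x ∈ B, w x ≤ 2 * N ∧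
        (#S : ℝ) ≤ c / (1 - q) * (#U : ℝ) ^ β := by
    intro A B S hs hA hS hw
    have hpos : 0 < #A := by
      rw [card_pos]
      by_contra hne
      rw [not_nonempty_iff_eq_empty] at hne
      simp [hne] at hw
    -- Recursion on the heavy side, with `N` fixed, so balance is always measured against the
    -- original total.
    obtain ⟨A', B', S', hs', hA', hB', hS'⟩ := h.weighted hc hβ w N A
      (by have := hs.sum w; omega)
    obtain ⟨A₁, B₁, h₁, hA₁, hB₁⟩ := hs.exists_refine_balanced hs' w hU hw hA' hB'
    refine ⟨A₁, B₁, _, h₁, hA₁, hB₁, ?_⟩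
    -- The orders form a geometric series of ratio `q`, summed by `c / (1 - q) * q + c = c / (1 -
    -- q)`.
    have hAU : (#A : ℝ) ^ β ≤ q * (#U : ℝ) ^ β := by
      rw [hqdef, ← Real.mul_rpow (by norm_num) (by positivity)]
      refine Real.rpow_le_rpow (by positivity) ?_ hβ.le
      have : (3 * #A : ℝ) ≤ 2 * #U := by exact_mod_cast hA
      linarith
    have hcu : (#(S' ∪ S) : ℝ) ≤ #S' + #S := by exact_mod_cast card_union_le S' S
    calc (#(S' ∪ S) : ℝ) ≤ c / (1 - q) * (q * (#U : ℝ) ^ β) + c * (#U : ℝ) ^ β := by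
          have : c / (1 - q) * (#A : ℝ) ^ β ≤ c / (1 - q) * (q * (#U : ℝ) ^ β) :=
            mul_le_mul_of_nonneg_left hAU (by linarith)
          linarith
      _ = c / (1 - q) * (#U : ℝ) ^ β := by
          have : 1 - q ≠ 0 := by linarith
          field_simp
          ring
  obtain ⟨A, B, S, hs, hA, hB, hS⟩ := h U
  by_cases hwA : 2 * N < 3 * ∑ x ∈ A, w x
  · exact heavy A B S hs hA hS hwA
  by_cases hwB : 2 * N < 3 * ∑ x ∈ B, w x
  · exact heavy B A S hs.symm hB hS hwB
  exact ⟨A, B, S, hs, not_lt.1 hwA, not_lt.1 hwB,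
    hS.trans (mul_le_mul_of_nonneg_right hle (by positivity))⟩
termination_by #U
decreasing_by
  have := hs.card
  omega

end Splits

/-! ### Region growing in a graph with small balls. -/

section Carving

variable {V : Type u}

/-- The ball of radius `j` around `v` in the subgraph of `G` induced by `R`. -/
noncomputable def ballIn (G : SimpleGraph V) (R : Finset V) (v : V) : ℕ → Finset V
  | 0 => {v}
  | j + 1 => {x ∈ R | x ∈ ballIn G R v j ∨ ∃ y ∈ ballIn G R v j, G.Adj y x}

lemma ballIn_subset (G : SimpleGraph V) {R : Finset V} {v : V} (hv : v ∈ R) (j : ℕ) :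
    ballIn G R v j ⊆ R := by
  cases j with
  | zero => simpa [ballIn] using hv
  | succ j => exact filter_subset _ _

lemma ballIn_mono (G : SimpleGraph V) {R : Finset V} {v : V} (hv : v ∈ R) :
    Monotone (ballIn G R v) :=
  monotone_nat_of_le_succ fun j _ hx => mem_filter.2 ⟨ballIn_subset G hv j hx, Or.inl hx⟩

lemma ballIn_subset_closedBall (G : SimpleGraph V) (R : Finset V) (v : V) (j : ℕ) :
    (ballIn G R v j : Set V) ⊆ closedBall G v j := by
  induction j with
  | zero => intro x hx; simp [ballIn] at hx; simp [closedBall, hx]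
  | succ j ih =>
    intro x hx
    have hmono : closedBall G v j ⊆ closedBall G v (j + 1) := fun y hy =>
      le_trans (show G.edist v y ≤ (j : ℕ∞) from hy) (by exact_mod_cast Nat.le_succ j)
    rcases (mem_filter.1 (mem_coe.1 hx)).2 with h | ⟨y, hy, hyx⟩
    · exact hmono (ih h)
    · calc G.edist v x ≤ G.edist v y + G.edist y x := SimpleGraph.edist_triangle
        _ ≤ (j : ℕ∞) + 1 := add_le_add (ih hy) (SimpleGraph.edist_eq_one_iff_adj.2 hyx).le
        _ = ((j + 1 : ℕ) : ℕ∞) := by push_cast; rfl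

/-- Region growing: starting from a vertex of maximum weight, some ball has a light boundary. -/
lemma exists_isSplit_light_boundary [Finite V] (G : SimpleGraph V) (w : V → ℕ) {k r M : ℕ}
    (hM : ∀ v, (closedBall G v r).ncard ≤ M) (hk : k ^ r * M < (k + 1) ^ r)
    (R : Finset V) (hR : 0 < ∑ x ∈ R, w x) :
    ∃ C Q L, IsSplit G R C Q L ∧ C.Nonempty ∧ #C ≤ M ∧ k * ∑ x ∈ L, w x ≤ ∑ x ∈ C, w x := by
  have hne : R.Nonempty := nonempty_of_sum_ne_zero hR.ne'
  obtain ⟨v, hv, hmax⟩ := exists_max_image R w hne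
  have hw : 0 < w v := by
    obtain ⟨x, hx, hx0⟩ := exists_ne_zero_of_sum_ne_zero hR.ne'
    have := hmax x hx
    omega
  let D := ballIn G R v
  have hcard : ∀ j ≤ r, #(D j) ≤ M := fun j hj => by
    refine le_trans ?_ (hM v)
    rw [← Set.ncard_coe_finset]
    exact Set.ncard_le_ncard ((coe_subset.2 (ballIn_mono G hv hj)).trans
      (ballIn_subset_closedBall G R v r)) (Set.toFinite _)
  -- Otherwise each step multiplies the weight by more than `(k + 1) / k`, whereas `D r` weighs at
  -- most `M * w v` because `v` is heaviest in `R`.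
  have hex : ∃ j < r, k * ∑ x ∈ D (j + 1) \ D j, w x ≤ ∑ x ∈ D j, w x := by
    by_contra! hcon
    have hgrow : ∀ j ≤ r, (k + 1) ^ j * w v ≤ k ^ j * ∑ x ∈ D j, w x := by
      intro j
      induction j with
      | zero => intro _; simp [D, ballIn]
      | succ j ih =>
        intro hj
        have h₁ := ih (by omega)
        have h₂ := hcon j (by omega)
        have h₃ := sum_sdiff (f := w) (ballIn_mono G hv (Nat.le_succ j))
        change ∑ x ∈ D (j + 1) \ D j, w x + ∑ x ∈ D j, w x = ∑ x ∈ D (j + 1), w x at h₃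
        calc (k + 1) ^ (j + 1) * w v = (k + 1) * ((k + 1) ^ j * w v) := by ring
          _ ≤ (k + 1) * (k ^ j * ∑ x ∈ D j, w x) := by gcongr
          _ = k ^ j * (k * ∑ x ∈ D j, w x + ∑ x ∈ D j, w x) := by ring
          _ ≤ k ^ j * (k * ∑ x ∈ D j, w x + k * ∑ x ∈ D (j + 1) \ D j, w x) := by gcongr
          _ = k ^ (j + 1) * ∑ x ∈ D (j + 1), w x := by rw [← h₃]; ring
    have hsum : ∑ x ∈ D r, w x ≤ M * w v := by
      refine (sum_le_card_nsmul _ _ _ fun x hx => hmax x (ballIn_subset G hv r hx)).trans ?_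
      rw [smul_eq_mul]
      exact Nat.mul_le_mul_right _ (hcard r le_rfl)
    have h₁ : (k + 1) ^ r * w v ≤ k ^ r * M * w v := by
      rw [mul_assoc]
      exact (hgrow r le_rfl).trans (Nat.mul_le_mul_left _ hsum)
    exact absurd (Nat.le_of_mul_le_mul_right h₁ hw) (by omega)
  obtain ⟨j, hj, hlight⟩ := hex
  have hsub := ballIn_mono G hv (Nat.le_succ j)
  refine ⟨D j, R \ D (j + 1), D (j + 1) \ D j, ⟨?_, ?_, disjoint_sdiff, ?_, ?_⟩,
    ⟨v, ballIn_mono G hv (Nat.zero_le j) (by simp [ballIn])⟩, hcard j hj.le, hlight⟩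
  · ext x
    have h₁ : x ∈ D j → x ∈ R := fun h => ballIn_subset G hv j h
    have h₂ : x ∈ D (j + 1) → x ∈ R := fun h => ballIn_subset G hv _ h
    simp only [mem_union, mem_sdiff]
    tauto
  · exact disjoint_left.2 fun x hx hx' => (mem_sdiff.1 hx').2 (hsub hx)
  · exact disjoint_left.2 fun x hx hx' => (mem_sdiff.1 hx).2 (mem_sdiff.1 hx').1
  · intro a ha b hb hab
    rw [mem_sdiff] at hb
    exact hb.2 (mem_filter.2 ⟨hb.1, Or.inr ⟨a, ha, hab⟩⟩)

/-- Carving off balls until a third of the weight has been passed leaves a small central part `C`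
separated from two parts `P` and `Q` by a light set `X`. -/
lemma exists_carving [Fintype V] (G : SimpleGraph V) (w : V → ℕ) {k r M : ℕ}
    (hM : ∀ v, (closedBall G v r).ncard ≤ M) (hk : k ^ r * M < (k + 1) ^ r) (R P X : Finset V)
    (hs : IsSplit G univ P R X) (hX : k * ∑ x ∈ X, w x ≤ ∑ x ∈ P, w x)
    (hP : 3 * ∑ x ∈ P, w x ≤ ∑ x, w x) :
    ∃ C P Q X, IsSplit G univ C (Q ∪ P) X ∧ IsSplit G univ Q (C ∪ P) X ∧
      #C ≤ M ∧ k * ∑ x ∈ X, w x ≤ ∑ x, w x ∧ 3 * ∑ x ∈ P, w x ≤ ∑ x, w x ∧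
      3 * ∑ x ∈ Q, w x ≤ 2 * ∑ x, w x := by
  have hsum := hs.sum w
  -- Invariant: `P` is what has been carved off, `R` what remains, and the boundaries `X` are
  -- charged to the weight of `P`.
  by_cases hR : 3 * ∑ x ∈ R, w x ≤ 2 * ∑ x, w x
  · have h₁ := hs.symm.refine (IsSplit.empty_left G R)
    have h₂ := hs.symm.refine (IsSplit.empty_left G R).symm
    rw [empty_union X] at h₁ h₂
    exact ⟨∅, P, R, X, h₁, h₂, by simp, by omega, hP, hR⟩
  · obtain ⟨C, Q, L, hsR, hC, hCM, hL⟩ :=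
      exists_isSplit_light_boundary G w hM hk R (by omega)
    have hsumR := hsR.sum w
    have h₁ := hs.symm.refine hsR
    have h₂ := hs.symm.refine hsR.symm
    have hdX : Disjoint L X :=
      disjoint_of_subset_left hsR.sep_subset hs.disjoint_right_sep
    have hdP : Disjoint C P := hs.symm.disjoint_right_of_left hsR.symm
    have hX' : k * ∑ x ∈ L ∪ X, w x ≤ ∑ x ∈ C ∪ P, w x := by
      rw [sum_union hdX, sum_union hdP, mul_add]; omega
    -- If adding `C` passes a third of the weight, then `Q` has at most two thirds and carving
    -- stops.
    by_cases hCP : 3 * ∑ x ∈ C ∪ P, w x ≤ ∑ x, w x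
    · exact exists_carving G w hM hk Q (C ∪ P) (L ∪ X) h₂.symm hX' hCP
    · have hsum₂ := h₂.sum w
      exact ⟨C, P, Q, L ∪ X, h₁, h₂, hCM, by omega, hP, by omega⟩
termination_by #R
decreasing_by
  have := hsR.card
  have := hC.card_pos
  omega

end Carving

/-! ### Balanced splits of subgraphs of a product. -/

section Product

variable {V V₁ V₂ : Type u}

/-- A balanced split of a graph that maps injectively into a product of a graph with balanced splits
and a graph with small balls. -/
lemma exists_isSplit_of_maps [Fintype V] [Fintype V₂] {K : SimpleGraph V} {G₁ : SimpleGraph V₁}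
    {G₂ : SimpleGraph V₂} {f₁ : V → V₁} {f₂ : V → V₂}
    (hinj : ∀ x y, f₁ x = f₁ y → f₂ x = f₂ y → x = y)
    (hf₁ : ∀ x y, K.Adj x y → f₁ x = f₁ y ∨ G₁.Adj (f₁ x) (f₁ y))
    (hf₂ : ∀ x y, K.Adj x y → f₂ x = f₂ y ∨ G₂.Adj (f₂ x) (f₂ y))
    {c β : ℝ} (hc : 0 < c) (hβ : 0 < β) (h₁ : HasBalancedSplits G₁ c β) {k r M : ℕ}
    (hM : ∀ v, (closedBall G₂ v r).ncard ≤ M) (hk : k ^ r * M < (k + 1) ^ r) :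
    ∃ A B S, IsSplit K univ A B S ∧ 3 * #A ≤ 2 * Fintype.card V ∧ 3 * #B ≤ 2 * Fintype.card V ∧
      (k : ℝ) * #S ≤ Fintype.card V +
        k * (M * (c / (1 - (2 / 3) ^ β) * (Fintype.card V : ℝ) ^ β)) := by
  have hC0 : 0 < c / (1 - (2 / 3 : ℝ) ^ β) :=
    div_pos hc (by linarith [Real.rpow_lt_one (x := 2 / 3) (by norm_num) (by norm_num) hβ])
  have hextra : 0 ≤ (k : ℝ) * (M * (c / (1 - (2 / 3) ^ β) * (Fintype.card V : ℝ) ^ β)) := by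
    positivity
  let w : V₂ → ℕ := fun y => #{x | f₂ x = y}
  have hw : ∀ T : Finset V₂, ∑ y ∈ T, w y = #{x | f₂ x ∈ T} := fun T => by
    rw [card_eq_sum_card_fiberwise (f := f₂) (t := T) (fun x hx => by simpa using hx)]
    refine sum_congr rfl fun y hy => congrArg Finset.card ?_
    ext x
    simp only [mem_filter, mem_univ, true_and]
    exact ⟨fun h => ⟨h ▸ hy, h⟩, fun h => h.2⟩
  have htot : ∑ y, w y = Fintype.card V := by rw [hw]; simp
  obtain ⟨C, P, Q, X, hs, hs', hCM, hX, hP, hQ⟩ := exists_carving G₂ w hM hk univ ∅ ∅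
    (IsSplit.empty_left G₂ univ) (by simp) (by simp)
  have hdP : Disjoint C P := disjoint_of_subset_right subset_union_right hs.disjoint_left_right
  have hdQ : Disjoint Q P := disjoint_of_subset_right subset_union_right hs'.disjoint_left_right
  have hsum := hs.sum w
  have hwCP := sum_union (f := w) hdP
  have hwQP := sum_union (f := w) hdQ
  have hp := hs.preimage f₂ hf₂ univ
  have hp' := hs'.preimage f₂ hf₂ univ
  simp only [mem_univ, filter_true] at hp hp'
  rw [htot] at hX hP hQ hsum
  have hXr : (k : ℝ) * #{x | f₂ x ∈ X} ≤ Fintype.card V := by rw [hw] at hX; exact_mod_cast hX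
  -- A light `C` is grouped with `P` against `Q`; a medium `C` stands alone against `Q ∪ P`; a heavy
  -- `C` must itself be split using `G₁`.
  by_cases hC₁ : 3 * ∑ y ∈ C, w y ≤ Fintype.card V
  · refine ⟨_, _, _, hp', ?_, ?_, by linarith⟩
    · rw [← hw]; exact hQ
    · rw [← hw]; omega
  by_cases hC₂ : 3 * ∑ y ∈ C, w y ≤ 2 * Fintype.card V
  · refine ⟨_, _, _, hp, ?_, ?_, by linarith⟩
    · rw [← hw]; exact hC₂
    · rw [← hw]; omega
  let T : Finset V := {x | f₂ x ∈ C}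
  let U : Finset V₁ := T.image f₁
  let w₁ : V₁ → ℕ := fun y => #{x ∈ T | f₁ x = y}
  have hw₁ : ∀ Z : Finset V₁, ∑ y ∈ Z, w₁ y = #{x ∈ T | f₁ x ∈ Z} := fun Z => by
    rw [card_eq_sum_card_fiberwise (f := f₁) (t := Z) (fun x hx => by
      have := (mem_filter.1 (mem_coe.1 hx)).2; exact this)]
    refine sum_congr rfl fun y hy => congrArg Finset.card ?_
    ext x
    simp only [mem_filter]
    exact ⟨fun h => ⟨⟨h.1, h.2 ▸ hy⟩, h.2⟩, fun h => ⟨h.1.1, h.2⟩⟩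
  obtain ⟨A, B, S, hsU, hA, hB, hS⟩ := h₁.weighted hc hβ w₁ (Fintype.card V) U
    (by rw [hw₁]; exact card_le_univ _)
  have hq := hsU.preimage f₁ hf₁ T
  have hTU : {x ∈ T | f₁ x ∈ U} = T :=
    filter_true_of_mem fun x hx => mem_image_of_mem f₁ hx
  rw [hTU] at hq
  rw [hw₁] at hA hB
  obtain ⟨A₁, B₁, hfin, hA₁, hB₁⟩ := hp.exists_refine_balanced hq (fun _ => 1)
    (N := Fintype.card V) (by simp) (by rw [hw] at hC₂; simpa using hC₂) (by simpa using hA)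
    (by simpa using hB)
  refine ⟨A₁, B₁, _, hfin, by simpa using hA₁, by simpa using hB₁, ?_⟩
  -- The part of `T` over `S` injects into `S × C`; this is where small balls bound the cost of
  -- lifting `S`.
  have hcardS : #{x ∈ T | f₁ x ∈ S} ≤ #S * #C := by
    rw [← card_product]
    refine card_le_card_of_injOn (fun x => (f₁ x, f₂ x)) ?_ ?_
    · intro x hx
      have hx' := mem_filter.1 (mem_coe.1 hx)
      exact mem_coe.2 (mem_product.2 ⟨hx'.2, (mem_filter.1 hx'.1).2⟩)
    · intro x _ y _ hxy
      exact hinj x y (congrArg Prod.fst hxy) (congrArg Prod.snd hxy)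
  have hUV : (#U : ℝ) ^ β ≤ (Fintype.card V : ℝ) ^ β :=
    Real.rpow_le_rpow (by positivity)
      (by exact_mod_cast card_image_le.trans (card_le_univ T)) hβ.le
  have hSr : (#{x ∈ T | f₁ x ∈ S} : ℝ) ≤
      M * (c / (1 - (2 / 3) ^ β) * (Fintype.card V : ℝ) ^ β) := by
    calc (#{x ∈ T | f₁ x ∈ S} : ℝ) ≤ #S * #C := by exact_mod_cast hcardS
      _ ≤ (c / (1 - (2 / 3) ^ β) * (Fintype.card V : ℝ) ^ β) * M := by
          refine mul_le_mul (hS.trans ?_) (by exact_mod_cast hCM) (by positivity) (by positivity)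
          exact mul_le_mul_of_nonneg_left hUV hC0.le
      _ = _ := mul_comm _ _
  have hun : (#({x ∈ T | f₁ x ∈ S} ∪ ({x | f₂ x ∈ X} : Finset V)) : ℝ) ≤
      #{x ∈ T | f₁ x ∈ S} + #{x | f₂ x ∈ X} := by exact_mod_cast card_union_le _ _
  calc (k : ℝ) * _ ≤ k * (#{x ∈ T | f₁ x ∈ S} + #{x | f₂ x ∈ X}) := by gcongr
    _ ≤ _ := by
      have := mul_le_mul_of_nonneg_left hSr (Nat.cast_nonneg (α := ℝ) k)
      linarith

end Product

/-! ### Choice of the scale `k`. -/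

section Asymptotics

/-- The square appears because balls are grown to radius `k ^ 2`. -/
lemma exists_forall_eval_sq_le (p : Polynomial ℝ) :
    ∃ (a : ℝ) (D : ℕ), 0 < a ∧ ∀ k : ℕ, 1 ≤ k → p.eval (((k ^ 2 : ℕ) : ℝ)) ≤ a * (k : ℝ) ^ D := by
  refine ⟨∑ i ∈ range (p.natDegree + 1), |p.coeff i| + 1, 2 * p.natDegree, by positivity, ?_⟩
  intro k hk
  have hk' : (1 : ℝ) ≤ k := by exact_mod_cast hk
  have hpow : (0 : ℝ) ≤ (k : ℝ) ^ (2 * p.natDegree) := by positivity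
  calc p.eval (((k ^ 2 : ℕ) : ℝ))
      = ∑ i ∈ range (p.natDegree + 1), p.coeff i * (k : ℝ) ^ (2 * i) := by
        rw [Polynomial.eval_eq_sum_range]
        exact sum_congr rfl fun i _ => by push_cast; rw [← pow_mul]
    _ ≤ ∑ i ∈ range (p.natDegree + 1), |p.coeff i| * (k : ℝ) ^ (2 * p.natDegree) := by
        refine sum_le_sum fun i hi => mul_le_mul (le_abs_self _) ?_ (by positivity) (abs_nonneg _)
        exact pow_le_pow_right₀ hk' (by have := mem_range.1 hi; omega)
    _ ≤ _ := by rw [← sum_mul]; nlinarith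

lemma exists_forall_mul_pow_lt_two_pow (a : ℝ) (D : ℕ) :
    ∃ k₀ : ℕ, 1 ≤ k₀ ∧ ∀ k ≥ k₀, a * (k : ℝ) ^ D < 2 ^ k := by
  have h := (tendsto_pow_const_div_const_pow_of_one_lt D (one_lt_two (α := ℝ))).const_mul a
  rw [mul_zero] at h
  obtain ⟨k₀, hk₀⟩ := Filter.eventually_atTop.1 (h.eventually (gt_mem_nhds one_pos))
  refine ⟨max k₀ 1, le_max_right _ _, fun k hk => ?_⟩
  have := hk₀ k (le_trans (le_max_left _ _) hk)
  rwa [← mul_div_assoc, div_lt_one (by positivity)] at this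

/-- By Bernoulli `(1 + 1/k) ^ k ≥ 2`, and the `k`-th power of this beats `M`. This supplies the
growth contradiction at radius `k ^ 2`. -/
lemma pow_sq_mul_lt {k M : ℕ} (hk : 1 ≤ k) (hM : M < 2 ^ k) :
    k ^ k ^ 2 * M < (k + 1) ^ k ^ 2 := by
  have hb : 2 * k ^ k ≤ (k + 1) ^ k := by
    have h := one_add_mul_le_pow (a := (1 / k : ℝ)) (by have : (0:ℝ) ≤ 1 / k := by positivity
                                                        linarith) k
    have hk' : (0 : ℝ) < k := by exact_mod_cast hk
    have e : (1 + 1 / k : ℝ) = (k + 1) / k := by field_simp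
    rw [e, div_pow, le_div_iff₀ (by positivity), mul_one_div_cancel hk'.ne'] at h
    have h2 : (2 * k ^ k : ℝ) ≤ (k + 1) ^ k := by linarith
    exact_mod_cast h2
  calc k ^ k ^ 2 * M < k ^ k ^ 2 * 2 ^ k := Nat.mul_lt_mul_of_pos_left hM (by positivity)
    _ = (2 * k ^ k) ^ k := by rw [mul_pow, ← pow_mul, sq, mul_comm]
    _ ≤ ((k + 1) ^ k) ^ k := Nat.pow_le_pow_left hb k
    _ = (k + 1) ^ k ^ 2 := by rw [← pow_mul, sq]

/-- The choice `k = ⌊n ^ ε⌋` makes `n / k + b * k ^ D * n ^ β` strongly sublinear. -/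
lemma exists_sublinear_bound {b β : ℝ} (hb : 0 < b) (hβ : β < 1) (hβ0 : 0 < β) (D k₀ : ℕ) :
    ∃ c γ : ℝ, 0 < c ∧ 0 ≤ γ ∧ γ < 1 ∧ ∀ n : ℕ, 1 ≤ n → (n : ℝ) ≤ c * (n : ℝ) ^ γ ∨
      ∃ k : ℕ, k₀ ≤ k ∧ 1 ≤ k ∧
        ∀ s : ℝ, k * s ≤ n + k * (b * (k : ℝ) ^ D * (n : ℝ) ^ β) → s ≤ c * (n : ℝ) ^ γ := by
  -- Small enough that `D * ε + β < 1`, the exponent of the second term; the first term `n / k` has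
  -- exponent `1 - ε`.
  set ε : ℝ := (1 - β) / (D + 1) / 2 with hε
  have hD : (0 : ℝ) < D + 1 := by positivity
  have hε0 : 0 < ε := div_pos (div_pos (by linarith) hD) two_pos
  have hεD : (D + 1) * ε = (1 - β) / 2 := by rw [hε]; field_simp
  have hDε : 0 ≤ D * ε := by positivity
  set γ : ℝ := max (1 - ε) (D * ε + β) with hγ
  have hγ1 : γ < 1 := max_lt (by linarith) (by nlinarith)
  have hγ0 : 0 ≤ γ := le_max_of_le_right (by linarith)
  set N₀ : ℝ := ((k₀ : ℝ) + 1) ^ (1 / ε)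
  have hN₀ : 0 < N₀ := by positivity
  -- `N₀` absorbs the `n` too small for `k ≥ k₀`, `2` the loss from the floor, and `b` the second
  -- term.
  refine ⟨N₀ + 2 + b, γ, by linarith, hγ0, hγ1, fun n hn => ?_⟩
  have hn1 : (1 : ℝ) ≤ n := by exact_mod_cast hn
  have hn0 : (0 : ℝ) < n := by linarith
  have hnγ : 1 ≤ (n : ℝ) ^ γ := Real.one_le_rpow hn1 hγ0
  by_cases hnN : (n : ℝ) ≤ N₀
  · left; nlinarith
  right
  have hx1 : 1 ≤ (n : ℝ) ^ ε := Real.one_le_rpow hn1 hε0.le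
  have hxk : (k₀ : ℝ) + 1 ≤ (n : ℝ) ^ ε := by
    have := Real.rpow_le_rpow hN₀.le (not_le.1 hnN).le hε0.le
    rwa [← Real.rpow_mul (by positivity), one_div_mul_cancel hε0.ne', Real.rpow_one] at this
  refine ⟨⌊(n : ℝ) ^ ε⌋₊, Nat.le_floor (by linarith), Nat.le_floor (by simpa using hx1), ?_⟩
  intro s hs
  set k : ℕ := ⌊(n : ℝ) ^ ε⌋₊
  have hk1 : 1 ≤ k := Nat.le_floor (by simpa using hx1)
  have hk0 : (0 : ℝ) < k := by exact_mod_cast hk1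
  have hkle : (k : ℝ) ≤ (n : ℝ) ^ ε := Nat.floor_le (by positivity)
  have hkge : (n : ℝ) ^ ε ≤ 2 * k := by
    have := Nat.lt_floor_add_one ((n : ℝ) ^ ε)
    have : (1 : ℝ) ≤ k := by exact_mod_cast hk1
    linarith
  have h₁ : (n : ℝ) ≤ k * (2 * (n : ℝ) ^ γ) := by
    calc (n : ℝ) = (n : ℝ) ^ ε * (n : ℝ) ^ (1 - ε) := by
          rw [← Real.rpow_add hn0]; simp
      _ ≤ (2 * k) * (n : ℝ) ^ γ := by
          gcongr
          exact le_max_left _ _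
      _ = _ := by ring
  have h₂ : (k : ℝ) ^ D * (n : ℝ) ^ β ≤ (n : ℝ) ^ γ := by
    calc (k : ℝ) ^ D * (n : ℝ) ^ β ≤ ((n : ℝ) ^ ε) ^ D * (n : ℝ) ^ β := by gcongr
      _ = (n : ℝ) ^ (D * ε + β) := by
          rw [Real.rpow_add hn0, mul_comm (D : ℝ) ε, Real.rpow_mul hn0.le, Real.rpow_natCast]
      _ ≤ (n : ℝ) ^ γ := Real.rpow_le_rpow_of_exponent_le hn1 (le_max_right _ _)
  have h₃ : (k : ℝ) * s ≤ k * ((2 + b) * (n : ℝ) ^ γ) := by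
    calc (k : ℝ) * s ≤ n + k * (b * (k : ℝ) ^ D * (n : ℝ) ^ β) := hs
      _ ≤ k * (2 * (n : ℝ) ^ γ) + k * (b * (n : ℝ) ^ γ) := by
          refine add_le_add h₁ (mul_le_mul_of_nonneg_left ?_ hk0.le)
          rw [mul_assoc]
          exact mul_le_mul_of_nonneg_left h₂ hb.le
      _ = _ := by ring
  have h₄ := le_of_mul_le_mul_left h₃ hk0
  nlinarith

end Asymptotics

/-! ### From graph classes to uniform constants. -/

section Classes

lemma HasStronglySublinearSeparators.exists_hasBalancedSplits {𝒢 : GraphClass.{u}}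
    (h : HasStronglySublinearSeparators 𝒢) :
    ∃ c β : ℝ, 0 < c ∧ β < 1 ∧ ∀ G ∈ 𝒢, HasBalancedSplits G.graph c β := by
  obtain ⟨c, β, hc, -, hβ, h⟩ := h
  exact ⟨c, β, hc, hβ, fun G hG => .of_subgraph_separations (h G hG)⟩

lemma HasBalancedSplits.mono {V : Type u} {G : SimpleGraph V} {c c' β β' : ℝ}
    (h : HasBalancedSplits G c β) (hc : 0 ≤ c) (hcc' : c ≤ c') (hββ' : β ≤ β') :
    HasBalancedSplits G c' β' := by
  intro U
  rcases U.eq_empty_or_nonempty with rfl | hU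
  · exact ⟨∅, ∅, ∅, IsSplit.empty_left G ∅, by simp, by simp, by
      simp only [card_empty, Nat.cast_zero]
      exact mul_nonneg (hc.trans hcc') (by positivity)⟩
  · obtain ⟨A, B, S, hs, hA, hB, hS⟩ := h U
    have h1 : (1 : ℝ) ≤ #U := by exact_mod_cast hU.card_pos
    exact ⟨A, B, S, hs, hA, hB, hS.trans
      (mul_le_mul hcc' (Real.rpow_le_rpow_of_exponent_le h1 hββ') (by positivity)
        (hc.trans hcc'))⟩

lemma BallsBoundedBy.ncard_le_floor {𝒢 : GraphClass.{u}} {r : ℕ} {b : ℝ}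
    (h : BallsBoundedBy 𝒢 r b) {G : FinGraph.{u}} (hG : G ∈ 𝒢) (v : G.V) :
    (closedBall G.graph v r).ncard ≤ ⌊b⌋₊ :=
  Nat.le_floor (h G hG v)

end Classes

end GraphProduct

theorem mainTheorem4 (𝒢₁ 𝒢₂ : GraphClass.{u})
    (h₁ : GraphProduct.HasStronglySublinearSeparators 𝒢₁)
    (h₂ : GraphProduct.HasStronglySublinearSeparators 𝒢₂)
    (hg : GraphProduct.JointPolynomialGrowth 𝒢₁ 𝒢₂) :
    GraphProduct.HasStronglySublinearSeparators (GraphProduct.strongProdClass 𝒢₁ 𝒢₂) := by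
  classical
  open GraphProduct Finset in
  obtain ⟨c₁, β₁, hc₁, hβ₁, h₁⟩ := h₁.exists_hasBalancedSplits
  obtain ⟨c₂, β₂, hc₂, hβ₂, h₂⟩ := h₂.exists_hasBalancedSplits
  obtain ⟨p, hp⟩ := hg
  obtain ⟨a, D, ha, hpa⟩ := exists_forall_eval_sq_le p
  obtain ⟨k₀, hk₀, hk₀'⟩ := exists_forall_mul_pow_lt_two_pow a D
  -- A common exponent for both classes, kept positive so that `(2 / 3) ^ β < 1`.
  set β : ℝ := max (1 / 2) (max β₁ β₂)
  have hβ0 : 0 < β := lt_max_of_lt_left (by norm_num)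
  have hβ : β < 1 := max_lt (by norm_num) (max_lt hβ₁ hβ₂)
  set c : ℝ := max c₁ c₂
  have hc : 0 < c := lt_max_of_lt_left hc₁
  have hC0 : 0 < c / (1 - (2 / 3 : ℝ) ^ β) :=
    div_pos hc (by linarith [Real.rpow_lt_one (x := 2 / 3) (by norm_num) (by norm_num) hβ0])
  set C : ℝ := c / (1 - (2 / 3 : ℝ) ^ β) with hC
  obtain ⟨c', γ, hc', hγ0, hγ1, hbound⟩ := exists_sublinear_bound (mul_pos ha hC0) hβ hβ0 D k₀
  refine ⟨c', γ, hc', hγ0, hγ1, ?_⟩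
  rintro G ⟨G₁, hG₁, G₂, hG₂, ⟨f⟩⟩ H
  have := G.finite
  have := G₁.finite
  have := G₂.finite
  let _ : Fintype H.verts := Fintype.ofFinite _
  let _ : Fintype G₁.V := Fintype.ofFinite _
  let _ : Fintype G₂.V := Fintype.ofFinite _
  suffices hsplit : ∃ A B S, IsSplit H.coe univ A B S ∧ 3 * #A ≤ 2 * Fintype.card H.verts ∧
      3 * #B ≤ 2 * Fintype.card H.verts ∧ (#S : ℝ) ≤ c' * (Fintype.card H.verts : ℝ) ^ γ by
    obtain ⟨A, B, S, hs, hA, hB, hS⟩ := hsplit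
    obtain ⟨A', B', hbal, hord⟩ := hs.exists_isBalancedSeparation hA hB
    exact ⟨A', B', hbal, by rw [hord, Nat.card_eq_fintype_card]; exact hS⟩
  have htriv : (Fintype.card H.verts : ℝ) ≤ c' * (Fintype.card H.verts : ℝ) ^ γ →
      ∃ A B S, IsSplit H.coe univ A B S ∧ 3 * #A ≤ 2 * Fintype.card H.verts ∧
      3 * #B ≤ 2 * Fintype.card H.verts ∧ (#S : ℝ) ≤ c' * (Fintype.card H.verts : ℝ) ^ γ :=
    fun h => ⟨∅, ∅, univ, by constructor <;> simp, by simp, by simp, h⟩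
  rcases Nat.eq_zero_or_pos (Fintype.card H.verts) with hn | hn
  · refine htriv ?_
    rw [hn, Nat.cast_zero]
    positivity
  rcases hbound _ hn with hsmall | ⟨k, hkk₀, hk1, hk⟩
  · exact htriv hsmall
  let g : H.verts → G₁.V × G₂.V := fun x => f x
  have hgadj : ∀ x y, H.coe.Adj x y → (strongProd G₁.graph G₂.graph).Adj (g x) (g y) :=
    fun x y hxy => f.toHom.map_adj (H.coe_adj_sub x y hxy)
  have hg₁ : ∀ x y, H.coe.Adj x y → (g x).1 = (g y).1 ∨ G₁.graph.Adj (g x).1 (g y).1 :=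
    fun x y hxy => by rcases hgadj x y hxy with h | h | h <;> simp [h]
  have hg₂ : ∀ x y, H.coe.Adj x y → (g x).2 = (g y).2 ∨ G₂.graph.Adj (g x).2 (g y).2 :=
    fun x y hxy => by rcases hgadj x y hxy with h | h | h <;> simp [h]
  have hinj : ∀ x y, (g x).1 = (g y).1 → (g x).2 = (g y).2 → x = y :=
    fun x y e₁ e₂ => Subtype.ext (f.injective (Prod.ext e₁ e₂))
  have hpk := hpa k hk1
  have hM : (⌊p.eval ((k ^ 2 : ℕ) : ℝ)⌋₊ : ℝ) ≤ a * (k : ℝ) ^ D := by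
    refine (Nat.cast_le.2 (Nat.floor_le_floor hpk)).trans (Nat.floor_le (by positivity))
  have hlt := pow_sq_mul_lt hk1 (M := ⌊p.eval ((k ^ 2 : ℕ) : ℝ)⌋₊)
    (by have := hM.trans_lt (hk₀' k hkk₀); exact_mod_cast this)
  have hfin : ∀ s : ℝ, k * s ≤ Fintype.card H.verts + k * (⌊p.eval ((k ^ 2 : ℕ) : ℝ)⌋₊ *
      (C * (Fintype.card H.verts : ℝ) ^ β)) → s ≤ c' * (Fintype.card H.verts : ℝ) ^ γ := by
    refine fun s hs => hk s (hs.trans ?_)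
    have : (⌊p.eval ((k ^ 2 : ℕ) : ℝ)⌋₊ : ℝ) * (C * (Fintype.card H.verts : ℝ) ^ β) ≤
        a * (k : ℝ) ^ D * (C * (Fintype.card H.verts : ℝ) ^ β) := by gcongr
    have := mul_le_mul_of_nonneg_left this (Nat.cast_nonneg (α := ℝ) k)
    linarith
  -- The factor with small balls depends on `k`, hence on `H`; the other one supplies the
  -- separators.
  rcases hp (k ^ 2) with hb | hb
  · obtain ⟨A, B, S, hs, hA, hB, hS⟩ := exists_isSplit_of_maps
      (fun x y e₂ e₁ => hinj x y e₁ e₂) hg₂ hg₁ hc hβ0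
      ((h₂ G₂ hG₂).mono hc₂.le (le_max_right _ _)
        ((le_max_right _ _).trans (le_max_right _ _)))
      (hb.ncard_le_floor hG₁) hlt
    exact ⟨A, B, S, hs, hA, hB, hfin _ hS⟩
  · obtain ⟨A, B, S, hs, hA, hB, hS⟩ := exists_isSplit_of_maps hinj hg₁ hg₂ hc hβ0
      ((h₁ G₁ hG₁).mono hc₁.le (le_max_left _ _)
        ((le_max_left _ _).trans (le_max_right _ _)))
      (hb.ncard_le_floor hG₂) hlt
    exact ⟨A, B, S, hs, hA, hB, hfin _ hS⟩
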